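/- Let $n \geq 3$ be an integer, let $(N,g_N)$ be a compact smooth Riemannian manifold (without boundary) of dimension $n-1$, and let $\rho \in \mathbb{R}$ be a constant such that $\mathrm{Ric}_N \geq (n-2)\rho\, g_N$. Let $0 < \bar r \leq \infty$ and let $h : [0,\bar r) \to \mathbb{R}$ be a smooth positive function (derivatives at $0$ are one-sided) such that (H1) $h'(0) = 0$ and $h''(0) > 0$; (H2) $h'(r) > 0$ for all $r \in (0,\bar r)$; (H3) the function $$2\,\frac{h''(r)}{h(r)} - (n-2)\,\frac{\rho - h'(r)^2}{h(r)^2}$$ is non-decreasing for $r \in (0,\bar r)$. Let $M = N \times [0,\bar r)$, a manifold with boundary $N \times \{0\}$, be equipped with the Riemannian metric $g = dr \otimes dr + h(r)^2\, g_N$, and define $f : M \to \mathbb{R}$ by $f = h'(r)$. Then $$(\Delta f)\, g - D^2 f + f\,\mathrm{Ric} \geq 0$$ at every point of $M$ (including the boundary points), in the sense that the symmetric $2$-tensor on the left is positive semidefinite. Here $\mathrm{Ric}$, $D^2$ and $\Delta = \mathrm{tr}_g D^2$ are the Ricci tensor, the Hessian and the Laplacian of $g$. -/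

import Mathlib

set_option maxSynthPendingDepth 3

open scoped Manifold ContDiff
open Bundle

noncomputable section

/-! ### Levi-Civita connection, Ricci tensor and Hessian in a coordinate domain

`E` is the coordinate space, `s ⊆ E` the set in which derivatives are taken (a half-space when the
manifold has a boundary), and `G x` is the matrix of the metric at `x`, as a bilinear form on `E`.
Everything is written without choosing a basis of `E`. -/

namespace CoordMetric

variable {E : Type*} [NormedAddCommGroup E] [NormedSpace ℝ E]

/-- The covector `w ↦ ½ ((∂_u G)(v, w) + (∂_v G)(u, w) - (∂_w G)(u, v))` at `x`, i.e. the Christoffel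
symbols of the first kind, as a bilinear function of `u` and `v`. -/
def christoffelFirst (G : E → E →L[ℝ] E →L[ℝ] ℝ) (s : Set E) (x : E) :
    E →L[ℝ] E →L[ℝ] E →L[ℝ] ℝ :=
  let D : E →L[ℝ] E →L[ℝ] E →L[ℝ] ℝ := fderivWithin ℝ G s x
  (1 / 2 : ℝ) •
    (D + D.flip - (ContinuousLinearMap.flipₗᵢ ℝ E E ℝ).toContinuousLinearEquiv.toContinuousLinearMap
      ∘L D.flip)

theorem christoffelFirst_apply (G : E → E →L[ℝ] E →L[ℝ] ℝ) (s : Set E) (x u v w : E) :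
    christoffelFirst G s x u v w =
      1 / 2 * (fderivWithin ℝ G s x u v w + fderivWithin ℝ G s x v u w
        - fderivWithin ℝ G s x w u v) := rfl

/-- The Christoffel symbols `Γ(u, v)` of the Levi-Civita connection: the vector with
`G(Γ(u, v), w) = ½ ((∂_u G)(v, w) + (∂_v G)(u, w) - (∂_w G)(u, v))` for all `w`. -/
def christoffel (G : E → E →L[ℝ] E →L[ℝ] ℝ) (s : Set E) (x : E) : E →L[ℝ] E →L[ℝ] E :=
  ContinuousLinearMap.compL ℝ E (E →L[ℝ] ℝ) E (G x).inverse ∘L christoffelFirst G s x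

theorem christoffel_apply (G : E → E →L[ℝ] E →L[ℝ] ℝ) (s : Set E) (x u v : E) :
    christoffel G s x u v = (G x).inverse (christoffelFirst G s x u v) := rfl

/-- The linear map `u ↦ R(u, v) w`, where
`R(u, v) w = ∇_u ∇_v w - ∇_v ∇_u w = (∂_u Γ)(v, w) - (∂_v Γ)(u, w) + Γ(u, Γ(v, w)) - Γ(v, Γ(u, w))`
for constant coordinate fields `u`, `v`, `w`. -/
def curvature (G : E → E →L[ℝ] E →L[ℝ] ℝ) (s : Set E) (x v w : E) : E →L[ℝ] E :=
  let Γ : E →L[ℝ] E →L[ℝ] E := christoffel G s x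
  let DΓ : E →L[ℝ] E →L[ℝ] E →L[ℝ] E := fderivWithin ℝ (christoffel G s) s x
  (DΓ.flip v).flip w - (DΓ v).flip w + Γ.flip (Γ v w) - Γ v ∘L Γ.flip w

theorem curvature_apply (G : E → E →L[ℝ] E →L[ℝ] ℝ) (s : Set E) (x u v w : E) :
    curvature G s x v w u =
      fderivWithin ℝ (christoffel G s) s x u v w - fderivWithin ℝ (christoffel G s) s x v u w
        + christoffel G s x u (christoffel G s x v w)
        - christoffel G s x v (christoffel G s x u w) := rfl

/-- The Ricci tensor `Ric(v, w) = tr (u ↦ R(u, v) w)` at `x`. -/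
def ricci (G : E → E →L[ℝ] E →L[ℝ] ℝ) (s : Set E) (x v w : E) : ℝ :=
  LinearMap.trace ℝ E (curvature G s x v w).toLinearMap

/-- The Hessian `(D²F)(u, v) = ∂_u ∂_v F - dF(Γ(u, v))` at `x`. -/
def hessian (G : E → E →L[ℝ] E →L[ℝ] ℝ) (s : Set E) (F : E → ℝ) (x : E) : E →L[ℝ] E →L[ℝ] ℝ :=
  fderivWithin ℝ (fderivWithin ℝ F s) s x
    - ContinuousLinearMap.compL ℝ E E ℝ (fderivWithin ℝ F s x) ∘L christoffel G s x

theorem hessian_apply (G : E → E →L[ℝ] E →L[ℝ] ℝ) (s : Set E) (F : E → ℝ) (x u v : E) :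
    hessian G s F x u v =
      fderivWithin ℝ (fderivWithin ℝ F s) s x u v
        - fderivWithin ℝ F s x (christoffel G s x u v) := rfl

/-- The Laplacian `ΔF = tr_G D²F` at `x`. -/
def laplacian (G : E → E →L[ℝ] E →L[ℝ] ℝ) (s : Set E) (F : E → ℝ) (x : E) : ℝ :=
  LinearMap.trace ℝ E ((G x).inverse ∘L hessian G s F x).toLinearMap

end CoordMetric

/-! ### Ricci tensor, Hessian and Laplacian on a manifold (possibly with boundary)

These are computed in the preferred chart at the point; the tangent space at `p` is identified with
the coordinate space by the differential of that same chart, as everywhere in Mathlib. -/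

section Manifold

variable {E : Type*} [NormedAddCommGroup E] [NormedSpace ℝ E] {H : Type*} [TopologicalSpace H]
  (I : ModelWithCorners ℝ E H) {M : Type*} [TopologicalSpace M] [ChartedSpace H M]

/-- The differential at `x` of the inverse `φ⁻¹` of the preferred chart `φ` at `p`. -/
def chartInvDeriv (p : M) (x : E) :
    E →L[ℝ] TangentSpace I ((extChartAt I p).symm x) :=
  mfderivWithin 𝓘(ℝ, E) I (extChartAt I p).symm (Set.range I) x

/-- The metric `g` in the preferred chart `φ` at `p`: the pullback of `g` by `φ⁻¹`. -/
def metricInChart (g : ∀ q : M, TangentSpace I q →L[ℝ] TangentSpace I q →L[ℝ] ℝ) (p : M) (x : E) :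
    E →L[ℝ] E →L[ℝ] ℝ :=
  let A : E →L[ℝ] E := chartInvDeriv I p x
  let B : E →L[ℝ] E →L[ℝ] ℝ := g ((extChartAt I p).symm x)
  B.bilinearComp A A

theorem metricInChart_apply (g : ∀ q : M, TangentSpace I q →L[ℝ] TangentSpace I q →L[ℝ] ℝ)
    (p : M) (x v w : E) :
    metricInChart I g p x v w =
      g ((extChartAt I p).symm x) (chartInvDeriv I p x v) (chartInvDeriv I p x w) := rfl

/-- The Ricci tensor of the metric `g`. -/
def ricciTensor (g : ∀ q : M, TangentSpace I q →L[ℝ] TangentSpace I q →L[ℝ] ℝ) (p : M)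
    (v w : TangentSpace I p) : ℝ :=
  CoordMetric.ricci (metricInChart I g p) (Set.range I) (extChartAt I p p) v w

/-- The Hessian `D²f` of the function `f` with respect to the metric `g`. -/
def hessianTensor (g : ∀ q : M, TangentSpace I q →L[ℝ] TangentSpace I q →L[ℝ] ℝ) (f : M → ℝ) (p : M)
    (v w : TangentSpace I p) : ℝ :=
  CoordMetric.hessian (metricInChart I g p) (Set.range I) (f ∘ (extChartAt I p).symm)
    (extChartAt I p p) v w

/-- The Laplacian `Δf` of the function `f` with respect to the metric `g`. -/
def laplaceBeltrami (g : ∀ q : M, TangentSpace I q →L[ℝ] TangentSpace I q →L[ℝ] ℝ) (f : M → ℝ)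
    (p : M) : ℝ :=
  CoordMetric.laplacian (metricInChart I g p) (Set.range I) (f ∘ (extChartAt I p).symm)
    (extChartAt I p p)

end Manifold

/-! ### The warped product `N × [0, R)` -/

/-- The interval `[0, R)` as a set of real numbers; `R = ∞` is allowed. -/
def halfOpenSet (R : EReal) : Set ℝ := {r | 0 ≤ r ∧ (r : EReal) < R}

/-- The interval `[0, R)` as a one-dimensional manifold with boundary `{0}`: an open subset of
the half-line `[0, ∞)`. -/
def HalfOpen (R : EReal) : TopologicalSpace.Opens (EuclideanHalfSpace 1) where
  carrier := {x | ((x.1 0 : ℝ) : EReal) < R}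
  is_open' := by
    refine isOpen_lt (continuous_coe_real_ereal.comp ?_) continuous_const
    exact (PiLp.continuous_apply 2 (fun _ : Fin 1 => ℝ) 0).comp continuous_subtype_val

section Warped

variable {E : Type*} [NormedAddCommGroup E] [NormedSpace ℝ E] {H : Type*} [TopologicalSpace H]
  (I : ModelWithCorners ℝ E H) {N : Type*} [TopologicalSpace N] [ChartedSpace H N] (R : EReal)

/-- The coordinate function `r` on `N × [0, R)`. -/
def radius {N : Type*} {R : EReal} (p : N × HalfOpen R) : ℝ := p.2.1.1 0

/-- The metric `dr ⊗ dr + h(r)² g_N` on `N × [0, R)`, where `g_N` is pulled back by the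
projection to `N`. -/
def warpedMetric (gN : ∀ x : N, TangentSpace I x →L[ℝ] TangentSpace I x →L[ℝ] ℝ) (h : ℝ → ℝ)
    (p : N × HalfOpen R) :
    TangentSpace (I.prod (𝓡∂ 1)) p →L[ℝ] TangentSpace (I.prod (𝓡∂ 1)) p →L[ℝ] ℝ :=
  let dr : (E × EuclideanSpace ℝ (Fin 1)) →L[ℝ] ℝ :=
    mvfderiv (I.prod (𝓡∂ 1)) (radius : N × HalfOpen R → ℝ) p
  let dπ : (E × EuclideanSpace ℝ (Fin 1)) →L[ℝ] E :=
    mfderiv (I.prod (𝓡∂ 1)) I (Prod.fst : N × HalfOpen R → N) p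
  let B : E →L[ℝ] E →L[ℝ] ℝ := gN p.1
  (ContinuousLinearMap.mul ℝ ℝ).bilinearComp dr dr + (h (radius p) ^ 2) • B.bilinearComp dπ dπ

theorem warpedMetric_apply (gN : ∀ x : N, TangentSpace I x →L[ℝ] TangentSpace I x →L[ℝ] ℝ)
    (h : ℝ → ℝ) (p : N × HalfOpen R) (v w : TangentSpace (I.prod (𝓡∂ 1)) p) :
    warpedMetric I R gN h p v w =
      mvfderiv (I.prod (𝓡∂ 1)) (radius : N × HalfOpen R → ℝ) p v *
          mvfderiv (I.prod (𝓡∂ 1)) (radius : N × HalfOpen R → ℝ) p w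
        + h (radius p) ^ 2 *
          gN p.1 (mfderiv (I.prod (𝓡∂ 1)) I (Prod.fst : N × HalfOpen R → N) p v)
            (mfderiv (I.prod (𝓡∂ 1)) I (Prod.fst : N × HalfOpen R → N) p w) := rfl

end Warped

end

/-! Write `m` for the dimension of `N`, so `m = n - 1`. In a product chart the metric is `dr² + h²
K`, with `K` the matrix of `g_N`, and everything can be computed explicitly: `Ric = Ric_N - (h h'' +
(m - 1) h'²) g_N - m (h''/h) dr²`, `D²f = h''' dr² + h h' h'' g_N`, `Δf = h''' + m h' h''/h`. In
`(Δf) g - D²f + f Ric` the coefficient of `dr²` cancels identically. What remains is tangential: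
`[h² h''' + (n - 3) h h' h'' + (n - 2)(ρ - h'²) h'] g_N + h' (Ric_N - (n - 2) ρ g_N)`. The bracket
is `h³/2` times the derivative of the function in (H3), hence nonnegative for `r > 0` and, by
continuity, at `r = 0` (`warping_inequality`). The second term is nonnegative since `h' ≥ 0` and by
the Ricci bound. The three formulas are `ricci_eq`, `hessian_eq` and `laplacian_eq`, proved for an
abstract warped metric on a half-space of `E × F`. `eventually_isWarpedAt` shows that the metric in
a chart has this form near the point, boundary points included, and `warpedProduct_nonneg` combines
everything. -/

open Set Filter Topology

/-! ### The metric read in the preferred chart: regularity and nondegeneracy. -/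

section MetricInChart

variable {E : Type*} [NormedAddCommGroup E] [NormedSpace ℝ E] {H : Type*} [TopologicalSpace H]
  {I : ModelWithCorners ℝ E H} {M : Type*} [TopologicalSpace M] [ChartedSpace H M]

/-- Bridge to the tangent bundle: injectivity and smoothness of the chart expression are then
inherited from the trivialization. -/
theorem chartInvDeriv_eq_symmL [IsManifold I 1 M] (p : M) {x : E}
    (hx : x ∈ (extChartAt I p).target) :
    chartInvDeriv I p x =
      (trivializationAt E (TangentSpace I : M → Type _) p).symmL ℝ ((extChartAt I p).symm x) := by
  rw [TangentBundle.symmL_trivializationAt, (extChartAt I p).right_inv hx]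
  · rfl
  · rw [← extChartAt_source I]
    exact (extChartAt I p).map_target hx

theorem chartInvDeriv_self [IsManifold I 1 M] (p : M) :
    (chartInvDeriv I p (extChartAt I p p) : E →L[ℝ] E) = ContinuousLinearMap.id ℝ E := by
  -- `φ⁻¹(φ p)` is `p` only up to a proof, so the base point is generalized before substituting.
  have h : ∀ q : M, q = p → ((trivializationAt E (TangentSpace I : M → Type _) p).symmL ℝ q :
      E →L[ℝ] E) = ContinuousLinearMap.id ℝ E := by
    rintro q rfl
    rw [TangentBundle.symmL_trivializationAt_eq_core (mem_chart_source H q)]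
    ext v
    exact tangentCoordChange_self (mem_extChartAt_source q)
  rw [chartInvDeriv_eq_symmL p (mem_extChartAt_target p)]
  exact h _ (extChartAt_to_inv p)

theorem metricInChart_self [IsManifold I 1 M]
    (g : ∀ q : M, TangentSpace I q →L[ℝ] TangentSpace I q →L[ℝ] ℝ) (p : M) :
    metricInChart I g p (extChartAt I p p) = (g p : E →L[ℝ] E →L[ℝ] ℝ) := by
  have h : ∀ q : M, q = p → ∀ A : E →L[ℝ] E, A = ContinuousLinearMap.id ℝ E →
      (show E →L[ℝ] E →L[ℝ] ℝ from g q).bilinearComp A A = (g p : E →L[ℝ] E →L[ℝ] ℝ) := by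
    rintro q rfl A rfl
    rfl
  exact h _ (extChartAt_to_inv p) _ (chartInvDeriv_self p)

theorem chartInvDeriv_injective [IsManifold I 1 M] (p : M) {x : E}
    (hx : x ∈ (extChartAt I p).target) : Function.Injective (chartInvDeriv I p x) := by
  have h : (extChartAt I p).symm x ∈
      (trivializationAt E (TangentSpace I : M → Type _) p).baseSet := by
    rw [TangentBundle.trivializationAt_baseSet, ← extChartAt_source I]
    exact (extChartAt I p).map_target hx
  rw [chartInvDeriv_eq_symmL p hx, ← Trivialization.symm_continuousLinearEquivAt_eq _ h]
  exact ContinuousLinearEquiv.injective _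

/-- Smoothness of a section of the bundle of bilinear forms means smoothness of its coordinate
expression in the trivialization at `p`. Composed with `φ⁻¹`, that expression is the matrix of the
metric. -/
theorem contDiffWithinAt_metricInChart [IsManifold I ∞ M]
    {g : ∀ q : M, TangentSpace I q →L[ℝ] TangentSpace I q →L[ℝ] ℝ}
    (hg : ContMDiff I (I.prod 𝓘(ℝ, E →L[ℝ] E →L[ℝ] ℝ)) ∞
      (fun b ↦ TotalSpace.mk' (E →L[ℝ] E →L[ℝ] ℝ) (E := fun b : M =>
        TangentSpace I b →L[ℝ] TangentSpace I b →L[ℝ] ℝ) b (g b))) (p : M) :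
    ContDiffWithinAt ℝ ∞ (metricInChart I g p) (range I) (extChartAt I p p) := by
  have h1 := ((contMDiffAt_hom_bundle _).1 (hg p)).2
  have h2 := ((contMDiffWithinAt_extChartAt_symm_range (I := I) (n := ∞) p
    (mem_extChartAt_target p)))
  have h3 := ContMDiffAt.comp_contMDiffWithinAt_of_eq h1 h2
    (extChartAt_to_inv (I := I) p)
  refine (contMDiffWithinAt_iff_contDiffWithinAt.1 h3).congr_of_eventuallyEq_of_mem ?_
    (mem_range_self _)
  filter_upwards [extChartAt_target_mem_nhdsWithin (I := I) p] with x hx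
  ext v w
  have hb : (extChartAt I p).symm x ∈ (chartAt H p).source := by
    rw [← extChartAt_source I]
    exact (extChartAt I p).map_target hx
  rw [metricInChart_apply, chartInvDeriv_eq_symmL p hx]
  simp only [Function.comp_apply]
  rw [inCoordinates_apply_eq₂ (by simpa using hb) (by simpa using hb) (by simp)]
  simp only [Trivial.fiberBundle_trivializationAt', Trivial.linearMapAt_trivialization,
    LinearMap.id_coe, id_eq]
  have hs : ∀ u : E, (trivializationAt E (TangentSpace I : M → Type _) p).symmL ℝ
      ((extChartAt I p).symm x) u = (trivializationAt E (TangentSpace I : M → Type _) p).symm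
      ((extChartAt I p).symm x) u := fun u =>
    Trivialization.symmL_apply _ (by simpa using hb) u
  exact congrArg₂ (fun a b => g _ a b) (hs v) (hs w)

end MetricInChart

/-! ### The warped metric in a product chart. -/

section Warped

variable {E : Type*} [NormedAddCommGroup E] [NormedSpace ℝ E] {H : Type*} [TopologicalSpace H]
  {I : ModelWithCorners ℝ E H} {N : Type*} [TopologicalSpace N] [ChartedSpace H N] {R : EReal}

/-- The chart on `[0, R)` is the inclusion whatever its base point, so `r` is a global coordinate.
-/
theorem radius_eq_extChartAt (p q : N × HalfOpen R) :
    radius q = (extChartAt (I.prod (𝓡∂ 1)) p q).2 0 := rfl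

theorem radius_extChartAt_symm (p : N × HalfOpen R) {z : E × EuclideanSpace ℝ (Fin 1)}
    (hz : z ∈ (extChartAt (I.prod (𝓡∂ 1)) p).target) :
    radius ((extChartAt (I.prod (𝓡∂ 1)) p).symm z) = z.2 0 := by
  rw [radius_eq_extChartAt (I := I) p, (extChartAt (I.prod (𝓡∂ 1)) p).right_inv hz]

theorem extChartAt_halfOpen_target (p : N × HalfOpen R) {z : E × EuclideanSpace ℝ (Fin 1)}
    (hz : z ∈ (extChartAt (I.prod (𝓡∂ 1)) p).target) : z.2 0 ∈ halfOpenSet R := by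
  rw [← radius_extChartAt_symm p hz]
  exact ⟨((extChartAt (I.prod (𝓡∂ 1)) p).symm z).2.1.2, ((extChartAt (I.prod (𝓡∂ 1)) p).symm z).2.2⟩

theorem mdifferentiableAt_radius (q : N × HalfOpen R) :
    MDifferentiableAt (I.prod (𝓡∂ 1)) 𝓘(ℝ, ℝ) (radius : N × HalfOpen R → ℝ) q := by
  have h1 : MDifferentiableAt (𝓡∂ 1) 𝓘(ℝ, EuclideanSpace ℝ (Fin 1)) (extChartAt (𝓡∂ 1) q.2) q.2 :=
    mdifferentiableAt_extChartAt (mem_chart_source _ _)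
  have h2 : MDifferentiableAt 𝓘(ℝ, EuclideanSpace ℝ (Fin 1)) 𝓘(ℝ, ℝ)
      (fun y : EuclideanSpace ℝ (Fin 1) => y 0) (extChartAt (𝓡∂ 1) q.2 q.2) :=
    (EuclideanSpace.proj (0 : Fin 1) : _ →L[ℝ] ℝ).differentiableAt.mdifferentiableAt
  exact (h2.comp _ h1).comp q mdifferentiableAt_snd

theorem mfderiv_radius_comp_chartInvDeriv [IsManifold I 1 N] (p : N × HalfOpen R)
    {z : E × EuclideanSpace ℝ (Fin 1)} (hz : z ∈ (extChartAt (I.prod (𝓡∂ 1)) p).target)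
    (v : E × EuclideanSpace ℝ (Fin 1)) :
    mvfderiv (I.prod (𝓡∂ 1)) (radius : N × HalfOpen R → ℝ)
      ((extChartAt (I.prod (𝓡∂ 1)) p).symm z) (chartInvDeriv (I.prod (𝓡∂ 1)) p z v) = v.2 0 := by
  have hr : z ∈ range (I.prod (𝓡∂ 1)) := extChartAt_target_subset_range p hz
  have hu : UniqueMDiffWithinAt 𝓘(ℝ, E × EuclideanSpace ℝ (Fin 1)) (range (I.prod (𝓡∂ 1))) z :=
    ((I.prod (𝓡∂ 1)).uniqueDiffOn z hr).uniqueMDiffWithinAt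
  have h := mfderiv_comp_mfderivWithin z (mdifferentiableAt_radius (I := I) (R := R)
    ((extChartAt (I.prod (𝓡∂ 1)) p).symm z)) (mdifferentiableWithinAt_extChartAt_symm hz) hu
  have h2 : (radius ∘ (extChartAt (I.prod (𝓡∂ 1)) p).symm) =ᶠ[𝓝[range (I.prod (𝓡∂ 1))] z]
      (fun z => z.2 0) := by
    filter_upwards [extChartAt_target_mem_nhdsWithin_of_mem hz] with y hy
      using radius_extChartAt_symm p hy
  have h3 : HasFDerivWithinAt (fun z : E × EuclideanSpace ℝ (Fin 1) => z.2 0)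
      ((EuclideanSpace.proj (0 : Fin 1) : _ →L[ℝ] ℝ) ∘L ContinuousLinearMap.snd ℝ E _)
      (range (I.prod (𝓡∂ 1))) z :=
    ((EuclideanSpace.proj (0 : Fin 1) : _ →L[ℝ] ℝ) ∘L
      ContinuousLinearMap.snd ℝ E _).hasFDerivWithinAt
  rw [h2.mfderivWithin_eq (radius_extChartAt_symm p hz),
    h3.hasMFDerivWithinAt.mfderivWithin hu] at h
  exact (DFunLike.congr_fun h v).symm

theorem mfderiv_fst_comp_chartInvDeriv [IsManifold I 1 N] (p : N × HalfOpen R)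
    {z : E × EuclideanSpace ℝ (Fin 1)} (hz : z ∈ (extChartAt (I.prod (𝓡∂ 1)) p).target)
    (v : E × EuclideanSpace ℝ (Fin 1)) :
    mfderiv (I.prod (𝓡∂ 1)) I (Prod.fst : N × HalfOpen R → N)
      ((extChartAt (I.prod (𝓡∂ 1)) p).symm z) (chartInvDeriv (I.prod (𝓡∂ 1)) p z v) =
      chartInvDeriv I p.1 z.1 v.1 := by
  have hr : z ∈ range (I.prod (𝓡∂ 1)) := extChartAt_target_subset_range p hz
  have hu : UniqueMDiffWithinAt 𝓘(ℝ, E × EuclideanSpace ℝ (Fin 1)) (range (I.prod (𝓡∂ 1))) z :=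
    ((I.prod (𝓡∂ 1)).uniqueDiffOn z hr).uniqueMDiffWithinAt
  have h := mfderiv_comp_mfderivWithin z (mdifferentiableAt_fst (I := I) (I' := 𝓡∂ 1)
    (x := (extChartAt (I.prod (𝓡∂ 1)) p).symm z)) (mdifferentiableWithinAt_extChartAt_symm hz) hu
  have hz1 : z.1 ∈ (extChartAt I p.1).target := by
    rw [extChartAt_prod] at hz
    exact hz.1
  have h2 : Prod.fst ∘ (extChartAt (I.prod (𝓡∂ 1)) p).symm =
      (extChartAt I p.1).symm ∘ Prod.fst := by
    rw [extChartAt_prod]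
    rfl
  have h3 : HasFDerivWithinAt (Prod.fst : E × EuclideanSpace ℝ (Fin 1) → E)
      (ContinuousLinearMap.fst ℝ E _) (range (I.prod (𝓡∂ 1))) z := hasFDerivWithinAt_fst
  have hsub : range (I.prod (𝓡∂ 1)) ⊆ Prod.fst ⁻¹' range I := by
    rintro _ ⟨y, rfl⟩
    exact ⟨y.1, rfl⟩
  have h4 := mfderivWithin_comp z (mdifferentiableWithinAt_extChartAt_symm (I := I) hz1)
    h3.hasMFDerivWithinAt.mdifferentiableWithinAt hsub hu
  rw [h3.hasMFDerivWithinAt.mfderivWithin hu] at h4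
  rw [h2, h4] at h
  exact (DFunLike.congr_fun h v).symm

theorem metricInChart_warpedMetric [IsManifold I 1 N]
    (gN : ∀ x : N, TangentSpace I x →L[ℝ] TangentSpace I x →L[ℝ] ℝ) (h : ℝ → ℝ)
    (p : N × HalfOpen R) {z : E × EuclideanSpace ℝ (Fin 1)}
    (hz : z ∈ (extChartAt (I.prod (𝓡∂ 1)) p).target) (v w : E × EuclideanSpace ℝ (Fin 1)) :
    metricInChart (I.prod (𝓡∂ 1)) (warpedMetric I R gN h) p z v w =
      v.2 0 * w.2 0 + h (z.2 0) ^ 2 * metricInChart I gN p.1 z.1 v.1 w.1 := by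
  rw [metricInChart_apply, warpedMetric_apply, metricInChart_apply,
    mfderiv_radius_comp_chartInvDeriv p hz, mfderiv_radius_comp_chartInvDeriv p hz,
    mfderiv_fst_comp_chartInvDeriv p hz, mfderiv_fst_comp_chartInvDeriv p hz,
    radius_extChartAt_symm p hz]
  rfl

end Warped

/-! ### Finite-dimensional calculus and linear algebra. -/

section FiniteDimensional

/-- A basis of `A` identifies `A →L B` with a finite power of `B`, where differentiability is
componentwise. -/
theorem differentiableWithinAt_clm_of_apply {X A B : Type*} [NormedAddCommGroup X]
    [NormedSpace ℝ X] [NormedAddCommGroup A] [NormedSpace ℝ A] [FiniteDimensional ℝ A]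
    [NormedAddCommGroup B] [NormedSpace ℝ B] {f : X → A →L[ℝ] B} {s : Set X} {x : X}
    (h : ∀ v, DifferentiableWithinAt ℝ (fun y => f y v) s x) :
    DifferentiableWithinAt ℝ f s x := by
  let e₁ := ContinuousLinearEquiv.ofFinrankEq (𝕜 := ℝ) (E := A)
    (F := Fin (Module.finrank ℝ A) → ℝ) (Module.finrank_fin_fun ℝ).symm
  let e₂ := (e₁.arrowCongr (1 : B ≃L[ℝ] B)).trans
    (ContinuousLinearEquiv.piRing (Fin (Module.finrank ℝ A)))
  rw [← Function.id_comp f, ← e₂.symm_comp_self]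
  exact e₂.symm.differentiable.differentiableAt.comp_differentiableWithinAt x
    (differentiableWithinAt_pi.2 fun i => h _)

/-- The derivative of a bilinear-form-valued map can be computed after evaluation. -/
theorem fderivWithin_apply_apply_of_hasFDerivWithinAt {X A B C : Type*} [NormedAddCommGroup X]
    [NormedSpace ℝ X] [NormedAddCommGroup A] [NormedSpace ℝ A] [FiniteDimensional ℝ A]
    [NormedAddCommGroup B] [NormedSpace ℝ B] [FiniteDimensional ℝ B]
    [NormedAddCommGroup C] [NormedSpace ℝ C] {f : X → A →L[ℝ] B →L[ℝ] C} {s : Set X} {x : X}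
    (hs : UniqueDiffWithinAt ℝ s x) {T : X → A → B → C}
    (h : ∀ v w, ∃ L : X →L[ℝ] C, HasFDerivWithinAt (fun y => f y v w) L s x ∧ ∀ u, L u = T u v w) (u : X) (v : A) (w : B) :
    fderivWithin ℝ f s x u v w = T u v w := by
  obtain ⟨L, hL, hT⟩ := h v w
  rw [← hT]
  have h1 : ∀ v, DifferentiableWithinAt ℝ (fun y => f y v) s x := fun v =>
    differentiableWithinAt_clm_of_apply fun w => (h v w).choose_spec.1.differentiableWithinAt
  have h2 : DifferentiableWithinAt ℝ f s x := differentiableWithinAt_clm_of_apply h1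
  have h3 : HasFDerivWithinAt (fun y => f y v w) (((fderivWithin ℝ f s x).flip v).flip w) s x := by
    have h4 := (h2.hasFDerivWithinAt.clm_apply (hasFDerivWithinAt_const v x s)).clm_apply
      (hasFDerivWithinAt_const w x s)
    convert h4 using 1
    ext
    simp
  exact (DFunLike.congr_fun (hs.eq hL h3) u).symm

theorem isInvertible_of_injective {A : Type*} [NormedAddCommGroup A] [NormedSpace ℝ A]
    [FiniteDimensional ℝ A] {B : A →L[ℝ] A →L[ℝ] ℝ} (h : Function.Injective B) :
    B.IsInvertible := by
  have hr : Module.finrank ℝ A = Module.finrank ℝ (A →L[ℝ] ℝ) := by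
    rw [← LinearEquiv.finrank_eq (LinearMap.toContinuousLinearMap : (A →ₗ[ℝ] ℝ) ≃ₗ[ℝ] _)]
    exact (Subspace.dual_finrank_eq).symm
  have : FiniteDimensional ℝ (A →L[ℝ] ℝ) :=
    LinearEquiv.finiteDimensional (LinearMap.toContinuousLinearMap : (A →ₗ[ℝ] ℝ) ≃ₗ[ℝ] _)
  refine ⟨(LinearEquiv.ofInjectiveOfFinrankEq B.toLinearMap h hr).toContinuousLinearEquiv, ?_⟩
  ext
  rfl

/-- Split `f` into its two block columns and use cyclicity of the trace. Thanks to this, only the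
diagonal blocks of the curvature need to be computed. -/
theorem trace_prod_eq_add {A B : Type*} [AddCommGroup A] [Module ℝ A] [FiniteDimensional ℝ A]
    [AddCommGroup B] [Module ℝ B] [FiniteDimensional ℝ B] (f : A × B →ₗ[ℝ] A × B) :
    LinearMap.trace ℝ (A × B) f =
      LinearMap.trace ℝ A (LinearMap.fst ℝ A B ∘ₗ f ∘ₗ LinearMap.inl ℝ A B) +
      LinearMap.trace ℝ B (LinearMap.snd ℝ A B ∘ₗ f ∘ₗ LinearMap.inr ℝ A B) := by
  have h : f = (f ∘ₗ LinearMap.inl ℝ A B) ∘ₗ LinearMap.fst ℝ A B +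
      (f ∘ₗ LinearMap.inr ℝ A B) ∘ₗ LinearMap.snd ℝ A B := by
    refine LinearMap.ext fun v => ?_
    simp only [LinearMap.add_apply, LinearMap.comp_apply, LinearMap.inl_apply,
      LinearMap.inr_apply, LinearMap.fst_apply, LinearMap.snd_apply]
    rw [← map_add]
    simp
  conv_lhs => rw [h]
  rw [map_add, LinearMap.trace_comp_comm' (LinearMap.fst ℝ A B),
    LinearMap.trace_comp_comm' (LinearMap.snd ℝ A B)]

end FiniteDimensional

/-! ### Christoffel symbols of a nondegenerate metric. -/

namespace CoordMetric

variable {E : Type*} [NormedAddCommGroup E] [NormedSpace ℝ E] [FiniteDimensional ℝ E]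

theorem christoffel_eq_of_apply {G : E → E →L[ℝ] E →L[ℝ] ℝ} {s : Set E} {x u v t : E}
    (hG : Function.Injective (G x)) (ht : ∀ w, G x t w = christoffelFirst G s x u v w) :
    christoffel G s x u v = t := by
  rw [christoffel_apply, (isInvertible_of_injective hG).inverse_apply_eq]
  ext w
  exact (ht w).symm

theorem apply_christoffel {G : E → E →L[ℝ] E →L[ℝ] ℝ} {s : Set E} {x : E}
    (hG : Function.Injective (G x)) (u v w : E) :
    G x (christoffel G s x u v) w = christoffelFirst G s x u v w := by
  rw [christoffel_apply, (isInvertible_of_injective hG).self_apply_inverse]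

theorem fderivWithin_symm {G : E → E →L[ℝ] E →L[ℝ] ℝ} {s : Set E} {x : E}
    (hs : UniqueDiffWithinAt ℝ s x) (hd : DifferentiableWithinAt ℝ G s x)
    (hG : ∀ x v w, G x v w = G x w v) (u v w : E) :
    fderivWithin ℝ G s x u v w = fderivWithin ℝ G s x u w v := by
  refine fderivWithin_apply_apply_of_hasFDerivWithinAt hs
    (fun v w => ⟨((fderivWithin ℝ G s x).flip w).flip v, ?_, fun _ => rfl⟩) u v w
  have h4 := (hd.hasFDerivWithinAt.clm_apply (hasFDerivWithinAt_const w x s)).clm_apply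
      (hasFDerivWithinAt_const v x s)
  convert h4 using 1
  · ext y
    exact hG y v w
  · ext
    simp

theorem christoffel_symm {G : E → E →L[ℝ] E →L[ℝ] ℝ} {s : Set E} {x : E}
    (hs : UniqueDiffWithinAt ℝ s x) (hd : DifferentiableWithinAt ℝ G s x)
    (hG : ∀ x v w, G x v w = G x w v) (u v : E) :
    christoffel G s x u v = christoffel G s x v u := by
  rw [christoffel_apply, christoffel_apply]
  congr 1
  ext w
  rw [christoffelFirst_apply, christoffelFirst_apply, fderivWithin_symm hs hd hG w u v]
  ring

/-- `Γ` is `G⁻¹` applied to first derivatives of `G`, and inversion is smooth at invertible maps. -/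
theorem differentiableWithinAt_christoffel {G : E → E →L[ℝ] E →L[ℝ] ℝ} {s : Set E} {x : E}
    (hs : UniqueDiffOn ℝ s) (hx : x ∈ s) (hG : ContDiffWithinAt ℝ ∞ G s x)
    (hi : Function.Injective (G x)) :
    DifferentiableWithinAt ℝ (christoffel G s) s x := by
  have h1 : DifferentiableWithinAt ℝ (fderivWithin ℝ G s) s x :=
    (hG.fderivWithin_right (m := 1) hs (WithTop.coe_le_coe.2 (le_top : (1 + 1 : ℕ∞) ≤ ⊤)) hx).differentiableWithinAt
      one_ne_zero
  have h2 : DifferentiableWithinAt ℝ (fun y => (G y).inverse) s x :=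
    ((isInvertible_of_injective hi).contDiffAt_map_inverse (n := 1)).differentiableAt one_ne_zero
      |>.comp_differentiableWithinAt x (hG.differentiableWithinAt (by simp))
  refine differentiableWithinAt_clm_of_apply fun u => differentiableWithinAt_clm_of_apply fun v => ?_
  refine h2.clm_apply (differentiableWithinAt_clm_of_apply fun w => ?_)
  change DifferentiableWithinAt ℝ (fun y => 1 / 2 * (fderivWithin ℝ G s y u v w
    + fderivWithin ℝ G s y v u w - fderivWithin ℝ G s y w u v)) s x
  fun_prop

end CoordMetric

/-! ### Christoffel symbols of a warped metric on a half-space, and their derivatives. -/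

namespace CoordMetric

variable {E : Type*} [NormedAddCommGroup E] [NormedSpace ℝ E] [FiniteDimensional ℝ E]
  {F : Type*} [NormedAddCommGroup F] [NormedSpace ℝ F] [FiniteDimensional ℝ F]

/-- In a neighbourhood of `z` in `{τ ≥ 0}`, the metric `G` is the warped product
`dτ² + h(τ)² K`, and its ingredients are differentiable at `z`. -/
structure IsWarpedAt (τ : F →L[ℝ] ℝ) (e : F) (h h₁ : ℝ → ℝ) (K : E → E →L[ℝ] E →L[ℝ] ℝ)
    (G : E × F → (E × F) →L[ℝ] (E × F) →L[ℝ] ℝ) (z : E × F) : Prop where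
  smul_eq : ∀ c, τ c • e = c
  apply_eq : τ e = 1
  nonneg : 0 ≤ τ z.2
  metric : ∀ᶠ y in 𝓝[{y | 0 ≤ τ y.2}] z, ∀ v w : E × F,
    G y v w = τ v.2 * τ w.2 + h (τ y.2) ^ 2 * K y.1 v.1 w.1
  injective : Function.Injective (K z.1)
  differentiable : DifferentiableAt ℝ K z.1
  symm : ∀ x v w, K x v w = K x w v
  ne_zero : h (τ z.2) ≠ 0
  deriv : HasDerivWithinAt h (h₁ (τ z.2)) (Ici 0) (τ z.2)

omit [FiniteDimensional ℝ E] [FiniteDimensional ℝ F] in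
theorem uniqueDiffOn_halfSpace {τ : F →L[ℝ] ℝ} {e : F} (he : τ e = 1) :
    UniqueDiffOn ℝ {y : E × F | 0 ≤ τ y.2} := by
  refine uniqueDiffOn_convex ?_ ⟨(0, e), ?_⟩
  · exact (convex_Ici (0 : ℝ)).linear_preimage
      ((τ ∘L ContinuousLinearMap.snd ℝ E F : E × F →L[ℝ] ℝ) : E × F →ₗ[ℝ] ℝ)
  · refine mem_interior.2 ⟨{y : E × F | 0 < τ y.2}, fun y (hy : 0 < τ y.2) => hy.le, ?_, ?_⟩
    · exact isOpen_lt continuous_const (by fun_prop)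
    · simp [he]

omit [FiniteDimensional ℝ E] [FiniteDimensional ℝ F] in
theorem hasFDerivWithinAt_comp_height {τ : F →L[ℝ] ℝ} {φ : ℝ → ℝ} {φ' : ℝ} {z : E × F}
    (hφ : HasDerivWithinAt φ φ' (Ici 0) (τ z.2)) :
    HasFDerivWithinAt (fun y : E × F => φ (τ y.2)) (φ' • (τ ∘L ContinuousLinearMap.snd ℝ E F))
      {y | 0 ≤ τ y.2} z :=
  hφ.comp_hasFDerivWithinAt z
    (τ ∘L ContinuousLinearMap.snd ℝ E F : E × F →L[ℝ] ℝ).hasFDerivWithinAt fun _ hy => hy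

omit [FiniteDimensional ℝ E] [FiniteDimensional ℝ F] in
theorem hasFDerivWithinAt_comp_fst {A : Type*} [NormedAddCommGroup A] [NormedSpace ℝ A]
    {f : E → A} {s : Set (E × F)} {z : E × F} (hf : DifferentiableAt ℝ f z.1) :
    HasFDerivWithinAt (fun y : E × F => f y.1)
      (fderiv ℝ f z.1 ∘L ContinuousLinearMap.fst ℝ E F) s z :=
  hf.hasFDerivAt.comp_hasFDerivWithinAt z hasFDerivWithinAt_fst

namespace IsWarpedAt

variable {τ : F →L[ℝ] ℝ} {e : F} {h h₁ : ℝ → ℝ} {K : E → E →L[ℝ] E →L[ℝ] ℝ}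
  {G : E × F → (E × F) →L[ℝ] (E × F) →L[ℝ] ℝ} {z : E × F}

omit [FiniteDimensional ℝ E] [FiniteDimensional ℝ F] in
theorem metric_self (H : IsWarpedAt τ e h h₁ K G z) (v w : E × F) :
    G z v w = τ v.2 * τ w.2 + h (τ z.2) ^ 2 * K z.1 v.1 w.1 :=
  H.metric.self_of_nhdsWithin H.nonneg v w

omit [FiniteDimensional ℝ E] [FiniteDimensional ℝ F] in
theorem metric_injective (H : IsWarpedAt τ e h h₁ K G z) : Function.Injective (G z) := by
  rw [injective_iff_map_eq_zero]
  intro v hv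
  have h2 : v.2 = 0 := by
    have := H.metric_self v (0, e)
    rw [← H.smul_eq v.2]
    have h3 : τ v.2 = 0 := by simpa [hv, H.apply_eq] using this.symm
    rw [h3, zero_smul]
  have h1 : v.1 = 0 := by
    refine (injective_iff_map_eq_zero _).1 H.injective _ ?_
    ext w
    have := H.metric_self v (w, 0)
    simpa [hv, H.ne_zero] using this.symm
  exact Prod.ext h1 h2

theorem fderivWithin_metric (H : IsWarpedAt τ e h h₁ K G z) (u v w : E × F) :
    fderivWithin ℝ G {y | 0 ≤ τ y.2} z u v w =
      2 * (h (τ z.2) * h₁ (τ z.2)) * τ u.2 * K z.1 v.1 w.1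
        + h (τ z.2) ^ 2 * fderiv ℝ K z.1 u.1 v.1 w.1 := by
  have hh := hasFDerivWithinAt_comp_height (E := E) (H.deriv.pow 2)
  have hK := hasFDerivWithinAt_comp_fst (F := F) (s := {y | 0 ≤ τ y.2}) H.differentiable
  refine fderivWithin_apply_apply_of_hasFDerivWithinAt (f := G)
    (T := fun u v w => 2 * (h (τ z.2) * h₁ (τ z.2)) * τ u.2 * K z.1 v.1 w.1
      + h (τ z.2) ^ 2 * fderiv ℝ K z.1 u.1 v.1 w.1)
    (uniqueDiffOn_halfSpace H.apply_eq z H.nonneg) (fun v w => ?_) u v w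
  refine ⟨_, ((hh.mul ((hK.clm_apply (hasFDerivWithinAt_const v.1 z _)).clm_apply
    (hasFDerivWithinAt_const w.1 z _))).const_add (τ v.2 * τ w.2)).congr_of_eventuallyEq
    (H.metric.mono fun y hy => hy v w) (H.metric_self v w), fun u => ?_⟩
  simp
  ring

/-- By nondegeneracy it suffices to pair the candidate with every `w` and compare with the
first-kind symbols. -/
theorem christoffel_apply (H : IsWarpedAt τ e h h₁ K G z) (u v : E × F) :
    christoffel G {y | 0 ≤ τ y.2} z u v =
      (christoffel K univ z.1 u.1 v.1 + (h₁ (τ z.2) / h (τ z.2)) • (τ u.2 • v.1 + τ v.2 • u.1),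
        -(h (τ z.2) * h₁ (τ z.2) * K z.1 u.1 v.1) • e) := by
  refine christoffel_eq_of_apply H.metric_injective fun w => ?_
  have h0 := H.ne_zero
  rw [H.metric_self, christoffelFirst_apply, H.fderivWithin_metric, H.fderivWithin_metric,
    H.fderivWithin_metric]
  simp only [map_add, map_smul, add_apply, smul_apply,
    smul_eq_mul, H.apply_eq]
  rw [apply_christoffel H.injective, christoffelFirst_apply]
  simp only [fderivWithin_univ]
  field_simp
  ring

variable {h₂ : ℝ → ℝ}

/-- The warped form is assumed near `z`, not just at `z`, because the formula for `Γ` is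
differentiated. -/
theorem fderivWithin_christoffel (H : ∀ᶠ y in 𝓝[{y | 0 ≤ τ y.2}] z, IsWarpedAt τ e h h₁ K G y)
    (hz : 0 ≤ τ z.2) (hΓ : DifferentiableAt ℝ (christoffel K univ) z.1)
    (hh : HasDerivWithinAt h₁ (h₂ (τ z.2)) (Ici 0) (τ z.2)) (u v w : E × F) :
    fderivWithin ℝ (christoffel G {y | 0 ≤ τ y.2}) {y | 0 ≤ τ y.2} z u v w =
      (fderiv ℝ (christoffel K univ) z.1 u.1 v.1 w.1
        + ((h₂ (τ z.2) * h (τ z.2) - h₁ (τ z.2) ^ 2) / h (τ z.2) ^ 2 * τ u.2) •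
          (τ v.2 • w.1 + τ w.2 • v.1),
        -((h₁ (τ z.2) ^ 2 + h (τ z.2) * h₂ (τ z.2)) * τ u.2 * K z.1 v.1 w.1
          + h (τ z.2) * h₁ (τ z.2) * fderiv ℝ K z.1 u.1 v.1 w.1) • e) := by
  have Hz := H.self_of_nhdsWithin hz
  have hφ := hasFDerivWithinAt_comp_height (E := E) (hh.div Hz.deriv Hz.ne_zero)
  have hψ := hasFDerivWithinAt_comp_height (E := E) (Hz.deriv.mul hh)
  have hK := hasFDerivWithinAt_comp_fst (F := F) (s := {y | 0 ≤ τ y.2}) Hz.differentiable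
  have hG := hasFDerivWithinAt_comp_fst (F := F) (s := {y | 0 ≤ τ y.2}) hΓ
  refine fderivWithin_apply_apply_of_hasFDerivWithinAt
    (f := christoffel G {y | 0 ≤ τ y.2}) 
    (T := fun u v w => (fderiv ℝ (christoffel K univ) z.1 u.1 v.1 w.1
        + ((h₂ (τ z.2) * h (τ z.2) - h₁ (τ z.2) ^ 2) / h (τ z.2) ^ 2 * τ u.2) •
          (τ v.2 • w.1 + τ w.2 • v.1),
        -((h₁ (τ z.2) ^ 2 + h (τ z.2) * h₂ (τ z.2)) * τ u.2 * K z.1 v.1 w.1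
          + h (τ z.2) * h₁ (τ z.2) * fderiv ℝ K z.1 u.1 v.1 w.1) • e))
    (uniqueDiffOn_halfSpace Hz.apply_eq z Hz.nonneg) (fun v w => ?_) u v w
  have h1 := ((hG.clm_apply (hasFDerivWithinAt_const v.1 z _)).clm_apply
    (hasFDerivWithinAt_const w.1 z _)).add (hφ.smul_const (τ v.2 • w.1 + τ w.2 • v.1))
  have h2 := (hψ.mul ((hK.clm_apply (hasFDerivWithinAt_const v.1 z _)).clm_apply
    (hasFDerivWithinAt_const w.1 z _))).neg.smul_const e
  refine ⟨_, (h1.prodMk h2).congr_of_eventuallyEq (H.mono fun y hy => hy.christoffel_apply v w)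
    (Hz.christoffel_apply v w), fun u => ?_⟩
  refine Prod.ext ?_ ?_
  · simp [sq]
  · simp
    congr 1
    ring

end IsWarpedAt

end CoordMetric

/-! ### Ricci tensor, Hessian and Laplacian of a warped metric. -/

namespace CoordMetric.IsWarpedAt

variable {E : Type*} [NormedAddCommGroup E] [NormedSpace ℝ E] [FiniteDimensional ℝ E]
  {F : Type*} [NormedAddCommGroup F] [NormedSpace ℝ F] [FiniteDimensional ℝ F]
  {τ : F →L[ℝ] ℝ} {e : F} {h h₁ h₂ : ℝ → ℝ} {K : E → E →L[ℝ] E →L[ℝ] ℝ}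
  {G : E × F → (E × F) →L[ℝ] (E × F) →L[ℝ] ℝ} {z : E × F}

theorem curvature_inl_fst (H : ∀ᶠ y in 𝓝[{y | 0 ≤ τ y.2}] z, IsWarpedAt τ e h h₁ K G y)
    (hz : 0 ≤ τ z.2) (hΓ : DifferentiableAt ℝ (christoffel K univ) z.1)
    (hh : HasDerivWithinAt h₁ (h₂ (τ z.2)) (Ici 0) (τ z.2)) (v : E × F) (u : E) :
    (curvature G {y | 0 ≤ τ y.2} z v v (u, 0)).1 =
      curvature K univ z.1 v.1 v.1 u
        + (-(h₁ (τ z.2) ^ 2 * K z.1 v.1 v.1) - h₂ (τ z.2) / h (τ z.2) * τ v.2 ^ 2) • u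
        + (h₁ (τ z.2) ^ 2 * K z.1 v.1 u) • v.1 := by
  have Hz := H.self_of_nhdsWithin hz
  have h0 := Hz.ne_zero
  -- Symmetry of the symbols of `K` is what lets the mixed terms of the two `ΓΓ` products cancel.
  have hs : christoffel K univ z.1 v.1 u = christoffel K univ z.1 u v.1 :=
    christoffel_symm uniqueDiffWithinAt_univ Hz.differentiable.differentiableWithinAt Hz.symm _ _
  rw [curvature_apply, curvature_apply, fderivWithin_christoffel H hz hΓ hh,
    fderivWithin_christoffel H hz hΓ hh]
  simp only [Hz.christoffel_apply, Prod.fst_add, Prod.fst_sub, map_add, map_smul, map_zero,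
    zero_smul, zero_add, mul_zero, fderivWithin_univ, Hz.apply_eq, hs,
    smul_eq_mul, Hz.symm z.1 u v.1, mul_one, smul_add, smul_smul]
  match_scalars <;> field_simp <;> ring

theorem curvature_inr_snd (H : ∀ᶠ y in 𝓝[{y | 0 ≤ τ y.2}] z, IsWarpedAt τ e h h₁ K G y)
    (hz : 0 ≤ τ z.2) (hΓ : DifferentiableAt ℝ (christoffel K univ) z.1)
    (hh : HasDerivWithinAt h₁ (h₂ (τ z.2)) (Ici 0) (τ z.2)) (v : E × F) (c : F) :
    (curvature G {y | 0 ≤ τ y.2} z v v (0, c)).2 =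
      (-(h (τ z.2) * h₂ (τ z.2) * K z.1 v.1 v.1) * τ c) • e := by
  have Hz := H.self_of_nhdsWithin hz
  have h0 := Hz.ne_zero
  rw [curvature_apply, fderivWithin_christoffel H hz hΓ hh,
    fderivWithin_christoffel H hz hΓ hh]
  simp only [Hz.christoffel_apply, Prod.snd_add, Prod.snd_sub, map_add, map_smul, map_zero,
    zero_add, add_zero, smul_zero, mul_zero, Hz.apply_eq,
    smul_eq_mul, mul_one, smul_add, smul_smul, zero_apply]
  match_scalars
  field_simp
  ring

/-- In the `E` block the identity has trace `dim E` and the rank-one term has trace `h₁² K(v, v)`,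
whence the coefficient `dim E - 1`. The `F` block, one-dimensional and spanned by `e`, contributes
`-h h₂ K(v, v)`. -/
theorem ricci_eq (H : ∀ᶠ y in 𝓝[{y | 0 ≤ τ y.2}] z, IsWarpedAt τ e h h₁ K G y)
    (hz : 0 ≤ τ z.2) (hΓ : DifferentiableAt ℝ (christoffel K univ) z.1)
    (hh : HasDerivWithinAt h₁ (h₂ (τ z.2)) (Ici 0) (τ z.2)) (v : E × F) :
    ricci G {y | 0 ≤ τ y.2} z v v =
      ricci K univ z.1 v.1 v.1
        - (h (τ z.2) * h₂ (τ z.2) + (Module.finrank ℝ E - 1) * h₁ (τ z.2) ^ 2) * K z.1 v.1 v.1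
        - Module.finrank ℝ E * (h₂ (τ z.2) / h (τ z.2)) * τ v.2 ^ 2 := by
  have Hz := H.self_of_nhdsWithin hz
  rw [ricci, ricci, trace_prod_eq_add]
  have h1 : LinearMap.fst ℝ E F ∘ₗ (curvature G {y | 0 ≤ τ y.2} z v v).toLinearMap ∘ₗ
      LinearMap.inl ℝ E F = (curvature K univ z.1 v.1 v.1).toLinearMap
        + (-(h₁ (τ z.2) ^ 2 * K z.1 v.1 v.1) - h₂ (τ z.2) / h (τ z.2) * τ v.2 ^ 2) •
          LinearMap.id
        + h₁ (τ z.2) ^ 2 • (K z.1 v.1).toLinearMap.smulRight v.1 := by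
    ext u
    simpa [smul_smul] using curvature_inl_fst H hz hΓ hh v u
  have h2 : LinearMap.snd ℝ E F ∘ₗ (curvature G {y | 0 ≤ τ y.2} z v v).toLinearMap ∘ₗ
      LinearMap.inr ℝ E F = -(h (τ z.2) * h₂ (τ z.2) * K z.1 v.1 v.1) •
        τ.toLinearMap.smulRight e := by
    ext c
    simpa [smul_smul] using curvature_inr_snd H hz hΓ hh v c
  rw [h1, h2]
  simp only [map_add, map_smul, LinearMap.trace_smulRight, LinearMap.trace_id, smul_eq_mul,
    ContinuousLinearMap.coe_coe, Hz.apply_eq]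
  ring

theorem hessian_eq {h₃ : ℝ} {f : E × F → ℝ}
    (H : ∀ᶠ y in 𝓝[{y | 0 ≤ τ y.2}] z, IsWarpedAt τ e h h₁ K G y) (hz : 0 ≤ τ z.2)
    (hf : ∀ᶠ y in 𝓝[{y | 0 ≤ τ y.2}] z, f y = h₁ (τ y.2))
    (hh₁ : ∀ᶠ y in 𝓝[{y | 0 ≤ τ y.2}] z,
      HasDerivWithinAt h₁ (h₂ (τ y.2)) (Ici 0) (τ y.2))
    (hh₂ : HasDerivWithinAt h₂ h₃ (Ici 0) (τ z.2)) (u v : E × F) :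
    hessian G {y | 0 ≤ τ y.2} f z u v =
      h₃ * τ u.2 * τ v.2 + h (τ z.2) * h₁ (τ z.2) * h₂ (τ z.2) * K z.1 u.1 v.1 := by
  have Hz := H.self_of_nhdsWithin hz
  have hs : UniqueDiffOn ℝ {y : E × F | 0 ≤ τ y.2} := uniqueDiffOn_halfSpace Hz.apply_eq
  have h1 : ∀ᶠ y in 𝓝[{y | 0 ≤ τ y.2}] z, fderivWithin ℝ f {y | 0 ≤ τ y.2} y =
      h₂ (τ y.2) • (τ ∘L ContinuousLinearMap.snd ℝ E F) := by
    -- The gradient of `f` is needed at all points near `z`, so `f = h₁ ∘ τ` is used around each of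
    -- them.
    filter_upwards [hh₁, eventually_eventually_nhdsWithin.2 hf, self_mem_nhdsWithin]
      with y hy hfy hys
    rw [Filter.EventuallyEq.fderivWithin_eq hfy (hfy.self_of_nhdsWithin hys)]
    exact (hasFDerivWithinAt_comp_height hy).fderivWithin (hs y hys)
  have h2 := (hasFDerivWithinAt_comp_height (E := E) hh₂).smul_const
    (τ ∘L ContinuousLinearMap.snd ℝ E F)
  rw [hessian_apply, Filter.EventuallyEq.fderivWithin_eq h1 (h1.self_of_nhdsWithin hz),
    h1.self_of_nhdsWithin hz, h2.fderivWithin (hs z hz), Hz.christoffel_apply]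
  simp [Hz.apply_eq]
  ring

theorem laplacian_eq {h₃ : ℝ} {f : E × F → ℝ}
    (H : ∀ᶠ y in 𝓝[{y | 0 ≤ τ y.2}] z, IsWarpedAt τ e h h₁ K G y) (hz : 0 ≤ τ z.2)
    (hf : ∀ᶠ y in 𝓝[{y | 0 ≤ τ y.2}] z, f y = h₁ (τ y.2))
    (hh₁ : ∀ᶠ y in 𝓝[{y | 0 ≤ τ y.2}] z,
      HasDerivWithinAt h₁ (h₂ (τ y.2)) (Ici 0) (τ y.2))
    (hh₂ : HasDerivWithinAt h₂ h₃ (Ici 0) (τ z.2)) :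
    laplacian G {y | 0 ≤ τ y.2} f z =
      h₃ + Module.finrank ℝ E * (h₁ (τ z.2) * h₂ (τ z.2) / h (τ z.2)) := by
  have Hz := H.self_of_nhdsWithin hz
  have h0 := Hz.ne_zero
  -- Raising an index turns the Hessian into a block-diagonal endomorphism, whose trace is
  -- immediate.
  have key : ∀ u : E × F, ((G z).inverse ∘L hessian G {y | 0 ≤ τ y.2} f z) u =
      ((h₁ (τ z.2) * h₂ (τ z.2) / h (τ z.2)) • u.1, (h₃ * τ u.2) • e) := by
    intro u
    rw [ContinuousLinearMap.comp_apply,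
      (isInvertible_of_injective Hz.metric_injective).inverse_apply_eq]
    refine ContinuousLinearMap.ext fun w => ?_
    rw [hessian_eq H hz hf hh₁ hh₂, Hz.metric_self]
    simp only [map_smul, smul_apply, smul_eq_mul, Hz.apply_eq]
    field_simp
  rw [laplacian, trace_prod_eq_add]
  have h1 : LinearMap.fst ℝ E F ∘ₗ ((G z).inverse ∘L hessian G {y | 0 ≤ τ y.2} f z).toLinearMap ∘ₗ
      LinearMap.inl ℝ E F = (h₁ (τ z.2) * h₂ (τ z.2) / h (τ z.2)) • LinearMap.id := by
    ext u
    exact congrArg Prod.fst (key (u, 0))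
  have h2 : LinearMap.snd ℝ E F ∘ₗ ((G z).inverse ∘L hessian G {y | 0 ≤ τ y.2} f z).toLinearMap ∘ₗ
      LinearMap.inr ℝ E F = h₃ • τ.toLinearMap.smulRight e := by
    ext c
    simpa [smul_smul] using congrArg Prod.snd (key (0, c))
  rw [h1, h2]
  simp only [map_smul, LinearMap.trace_smulRight, LinearMap.trace_id, smul_eq_mul,
    ContinuousLinearMap.coe_coe, Hz.apply_eq]
  ring

end CoordMetric.IsWarpedAt

/-! ### One-variable analysis of the warping function on `[0, R)`. -/

section HalfOpenInterval

variable {R : EReal}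

theorem isOpen_coe_lt (R : EReal) : IsOpen {r : ℝ | (r : EReal) < R} :=
  isOpen_lt continuous_coe_real_ereal continuous_const

theorem uniqueDiffOn_halfOpenSet (R : EReal) : UniqueDiffOn ℝ (halfOpenSet R) :=
  (uniqueDiffOn_Ici (0 : ℝ)).inter (isOpen_coe_lt R)

theorem hasDerivWithinAt_Ici_of_contDiffOn {φ : ℝ → ℝ} (hφ : ContDiffOn ℝ ∞ φ (halfOpenSet R))
    {r : ℝ} (hr : r ∈ halfOpenSet R) :
    HasDerivWithinAt φ (derivWithin φ (halfOpenSet R) r) (Ici 0) r := by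
  refine ((hφ.differentiableOn (by simp)) r hr).hasDerivWithinAt.mono_of_mem_nhdsWithin ?_
  exact inter_mem self_mem_nhdsWithin (mem_nhdsWithin_of_mem_nhds ((isOpen_coe_lt R).mem_nhds hr.2))

theorem contDiffOn_derivWithin_halfOpenSet {φ : ℝ → ℝ}
    (hφ : ContDiffOn ℝ ∞ φ (halfOpenSet R)) :
    ContDiffOn ℝ ∞ (derivWithin φ (halfOpenSet R)) (halfOpenSet R) :=
  hφ.derivWithin (uniqueDiffOn_halfOpenSet R) (by simp)

theorem iteratedDerivWithin_two_eq (φ : ℝ → ℝ) (r : ℝ) :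
    iteratedDerivWithin 2 φ (halfOpenSet R) r =
      derivWithin (derivWithin φ (halfOpenSet R)) (halfOpenSet R) r := by
  rw [iteratedDerivWithin_succ]
  refine derivWithin_congr (fun x hx => ?_) ?_
  · exact congrFun iteratedDerivWithin_one x
  · exact congrFun iteratedDerivWithin_one r

/-- The differentiated form of the monotonicity hypothesis on the warping function. -/
theorem warping_inequality {h : ℝ → ℝ} {ρ n : ℝ}
    (h_smooth : ContDiffOn ℝ ∞ h (halfOpenSet R)) (h_pos : ∀ r ∈ halfOpenSet R, 0 < h r)
    (hmono : MonotoneOn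
      (fun r => 2 * (iteratedDerivWithin 2 h (halfOpenSet R) r / h r)
        - (n - 2) * ((ρ - derivWithin h (halfOpenSet R) r ^ 2) / h r ^ 2))
      {r | r ∈ halfOpenSet R ∧ 0 < r}) {r : ℝ} (hr : r ∈ halfOpenSet R) :
    0 ≤ h r ^ 2 * derivWithin (derivWithin (derivWithin h (halfOpenSet R)) (halfOpenSet R))
          (halfOpenSet R) r
      + (n - 3) * h r * derivWithin h (halfOpenSet R) r *
        derivWithin (derivWithin h (halfOpenSet R)) (halfOpenSet R) r
      + (n - 2) * (ρ - derivWithin h (halfOpenSet R) r ^ 2) * derivWithin h (halfOpenSet R) r := by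
  set D := halfOpenSet R with hD
  set h₁ := derivWithin h D with hh₁
  set h₂ := derivWithin h₁ D with hh₂
  set h₃ := derivWithin h₂ D with hh₃
  have c₁ : ContDiffOn ℝ ∞ h₁ D := contDiffOn_derivWithin_halfOpenSet h_smooth
  have c₂ : ContDiffOn ℝ ∞ h₂ D := contDiffOn_derivWithin_halfOpenSet c₁
  have c₃ : ContDiffOn ℝ ∞ h₃ D := contDiffOn_derivWithin_halfOpenSet c₂
  have hpos : ∀ r ∈ D, 0 < r → 0 ≤ h r ^ 2 * h₃ r + (n - 3) * h r * h₁ r * h₂ r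
      + (n - 2) * (ρ - h₁ r ^ 2) * h₁ r := by
    intro r hr hr0
    -- Away from the endpoint, derivatives within the interval are ordinary derivatives.
    have hnhds : {r | r ∈ D ∧ 0 < r} ∈ 𝓝 r := by
      filter_upwards [(isOpen_coe_lt R).mem_nhds hr.2, lt_mem_nhds hr0] with x hx hx0
        using ⟨⟨hx0.le, hx⟩, hx0⟩
    have hi : Ici (0 : ℝ) ∈ 𝓝 r := Ici_mem_nhds hr0
    have d₀ := (hasDerivWithinAt_Ici_of_contDiffOn h_smooth hr).hasDerivAt hi
    have d₁ := (hasDerivWithinAt_Ici_of_contDiffOn c₁ hr).hasDerivAt hi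
    have d₂ := (hasDerivWithinAt_Ici_of_contDiffOn c₂ hr).hasDerivAt hi
    rw [← hD, ← hh₁] at d₀
    rw [← hD, ← hh₂] at d₁
    rw [← hD, ← hh₃] at d₂
    have hne := (h_pos r hr).ne'
    have hder := ((d₂.div d₀ hne).const_mul 2).sub
      ((((d₁.pow 2).const_sub ρ).div (d₀.pow 2) (pow_ne_zero 2 hne)).const_mul (n - 2))
    have hmono' : MonotoneOn (fun r => 2 * (h₂ r / h r) - (n - 2) * ((ρ - h₁ r ^ 2) / h r ^ 2))
        {r | r ∈ D ∧ 0 < r} := by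
      have hit : ∀ x, iteratedDerivWithin 2 h D x = h₂ x := iteratedDerivWithin_two_eq h
      simpa only [hit] using hmono
    have hnn := hmono'.derivWithin_nonneg (x := r)
    rw [derivWithin_of_mem_nhds hnhds] at hnn
    erw [hder.deriv] at hnn
    -- Multiplying the derivative of the monotone function by `h³/2` clears its denominators and
    -- gives exactly the claimed expression.
    have h3 : 0 < h r ^ 3 / 2 := by have := h_pos r hr; positivity
    refine (mul_nonneg h3.le hnn).trans_eq ?_
    simp
    field_simp
    ring
  rcases hr.1.eq_or_lt with h0 | h0
  -- At `r = 0` monotonicity gives nothing directly; the inequality is the limit of those at `r >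
  -- 0`, as `h` and its derivatives are continuous up to the endpoint.
  · have hcont : ContinuousWithinAt (fun r => h r ^ 2 * h₃ r + (n - 3) * h r * h₁ r * h₂ r
        + (n - 2) * (ρ - h₁ r ^ 2) * h₁ r) D r := by
      have e₀ := h_smooth.continuousOn r hr
      have e₁ := c₁.continuousOn r hr
      have e₂ := c₂.continuousOn r hr
      have e₃ := c₃.continuousOn r hr
      fun_prop
    have hev : ∀ᶠ x in 𝓝[>] r, x ∈ D ∧ 0 < x := by
      filter_upwards [self_mem_nhdsWithin,
        mem_nhdsWithin_of_mem_nhds ((isOpen_coe_lt R).mem_nhds hr.2)] with x hx hxR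
      have hx0 : 0 < x := h0.trans_lt hx
      exact ⟨⟨hx0.le, hxR⟩, hx0⟩
    have hle : 𝓝[>] r ≤ 𝓝[D] r :=
      le_inf nhdsWithin_le_nhds (le_principal_iff.2 (hev.mono fun x hx => hx.1))
    exact ge_of_tendsto (hcont.tendsto.mono_left hle) (hev.mono fun x hx => hpos x hx.1 hx.2)
  · exact hpos r hr h0

end HalfOpenInterval

/-! ### From charts to the manifold: the inequality on `N × [0, R)`. -/

section WarpedProduct

variable {E : Type*} [NormedAddCommGroup E] [NormedSpace ℝ E] [FiniteDimensional ℝ E]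
  {H : Type*} [TopologicalSpace H] {I : ModelWithCorners ℝ E H} [I.Boundaryless]
  {N : Type*} [TopologicalSpace N] [ChartedSpace H N] {R : EReal}

omit [FiniteDimensional ℝ E] in
theorem range_prod_halfOpen :
    range (I.prod (𝓡∂ 1)) = {y : E × EuclideanSpace ℝ (Fin 1) |
      0 ≤ (EuclideanSpace.proj (0 : Fin 1) : EuclideanSpace ℝ (Fin 1) →L[ℝ] ℝ) y.2} := by
  rw [modelWithCorners_prod_coe, range_prodMap, I.range_eq_univ,
    range_modelWithCornersEuclideanHalfSpace]
  ext y
  simp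

omit [FiniteDimensional ℝ E] [I.Boundaryless] in
theorem metricInChart_injective [IsManifold I 1 N]
    {g : ∀ q : N, TangentSpace I q →L[ℝ] TangentSpace I q →L[ℝ] ℝ}
    (hpos : ∀ q v, v ≠ 0 → 0 < g q v v) (p : N) {x : E} (hx : x ∈ (extChartAt I p).target) :
    Function.Injective (metricInChart I g p x) := by
  rw [injective_iff_map_eq_zero]
  intro v hv
  have h1 : g ((extChartAt I p).symm x) (chartInvDeriv I p x v) (chartInvDeriv I p x v) = 0 := by
    rw [← metricInChart_apply, hv]
    rfl
  by_contra hne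
  refine (hpos _ _ fun h0 => hne ?_).ne' h1
  exact (injective_iff_map_eq_zero (chartInvDeriv I p x)).1 (chartInvDeriv_injective p hx) v h0

variable [IsManifold I ∞ N]

open CoordMetric

omit [FiniteDimensional ℝ E] in
-- The chart target is a neighbourhood, within the half-space, of each of its points, so the warped
-- form holds around every nearby point, including those on the boundary.
theorem eventually_isWarpedAt (gN : ContMDiffRiemannianMetric I ∞ E (TangentSpace I : N → Type _))
    {h : ℝ → ℝ} (h_smooth : ContDiffOn ℝ ∞ h (halfOpenSet R))
    (h_pos : ∀ r ∈ halfOpenSet R, 0 < h r) (p : N × HalfOpen R) :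
    ∀ᶠ y in 𝓝[{y : E × EuclideanSpace ℝ (Fin 1) |
        0 ≤ (EuclideanSpace.proj (0 : Fin 1) : EuclideanSpace ℝ (Fin 1) →L[ℝ] ℝ) y.2}]
        (extChartAt (I.prod (𝓡∂ 1)) p p),
      IsWarpedAt (EuclideanSpace.proj (0 : Fin 1)) (EuclideanSpace.single 0 1) h
        (derivWithin h (halfOpenSet R)) (metricInChart I gN.inner p.1)
        (metricInChart (I.prod (𝓡∂ 1)) (warpedMetric I R gN.inner h) p) y := by
  have hd : ∀ᶠ x in 𝓝 (extChartAt I p.1 p.1),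
      DifferentiableAt ℝ (metricInChart I gN.inner p.1) x := by
    have h1 := contDiffWithinAt_metricInChart gN.contMDiff p.1
    rw [I.range_eq_univ, contDiffWithinAt_univ] at h1
    exact ((h1.of_le (m := 1) (by simp)).eventually (by simp)).mono fun x hx =>
      hx.differentiableAt one_ne_zero
  have hd' := (continuous_fst.tendsto (extChartAt (I.prod (𝓡∂ 1)) p p)).eventually hd
  rw [← range_prod_halfOpen (I := I)]
  filter_upwards [extChartAt_target_mem_nhdsWithin (I := I.prod (𝓡∂ 1)) p,
    mem_nhdsWithin_of_mem_nhds hd'] with y hy hyd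
  have hyR := extChartAt_halfOpen_target p hy
  have hy1 : y.1 ∈ (extChartAt I p.1).target := by
    rw [extChartAt_prod] at hy
    exact hy.1
  refine ⟨fun c => ?_, ?_, hyR.1, ?_, metricInChart_injective gN.pos p.1 hy1, hyd, ?_,
    (h_pos _ hyR).ne', hasDerivWithinAt_Ici_of_contDiffOn h_smooth hyR⟩
  · ext i
    fin_cases i
    simp
  · simp
  · rw [← range_prod_halfOpen (I := I)]
    filter_upwards [extChartAt_target_mem_nhdsWithin_of_mem hy] with x hx v w
      using metricInChart_warpedMetric gN.inner h p hx v w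
  · intro x v w
    rw [metricInChart_apply, metricInChart_apply, gN.symm]

/-- The static inequality on a warped product over a closed manifold with Ricci lower bound. -/
theorem warpedProduct_nonneg {n : ℝ} (hn : (Module.finrank ℝ E : ℝ) = n - 1)
    (gN : ContMDiffRiemannianMetric I ∞ E (TangentSpace I : N → Type _)) (ρ : ℝ)
    (hRic : ∀ (x : N) (v : TangentSpace I x),
      (n - 2) * ρ * gN.inner x v v ≤ ricciTensor I gN.inner x v v)
    (h : ℝ → ℝ) (h_smooth : ContDiffOn ℝ ∞ h (halfOpenSet R))
    (h_pos : ∀ r ∈ halfOpenSet R, 0 < h r)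
    (h_nonneg : ∀ r ∈ halfOpenSet R, 0 ≤ derivWithin h (halfOpenSet R) r)
    (h_mono : MonotoneOn
      (fun r => 2 * (iteratedDerivWithin 2 h (halfOpenSet R) r / h r)
        - (n - 2) * ((ρ - derivWithin h (halfOpenSet R) r ^ 2) / h r ^ 2))
      {r | r ∈ halfOpenSet R ∧ 0 < r})
    (f : N × HalfOpen R → ℝ) (hf : ∀ p, f p = derivWithin h (halfOpenSet R) (radius p))
    (p : N × HalfOpen R) (v : TangentSpace (I.prod (𝓡∂ 1)) p) :
    0 ≤ laplaceBeltrami (I.prod (𝓡∂ 1)) (warpedMetric I R gN.inner h) f p *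
        warpedMetric I R gN.inner h p v v
      - hessianTensor (I.prod (𝓡∂ 1)) (warpedMetric I R gN.inner h) f p v v
      + f p * ricciTensor (I.prod (𝓡∂ 1)) (warpedMetric I R gN.inner h) p v v := by
  let J := I.prod (𝓡∂ 1)
  let D := halfOpenSet R
  let h₁ := derivWithin h D
  let h₂ := derivWithin h₁ D
  let h₃ := derivWithin h₂ D
  let K := metricInChart I gN.inner p.1
  let G := metricInChart J (warpedMetric I R gN.inner h) p
  let τ : EuclideanSpace ℝ (Fin 1) →L[ℝ] ℝ := EuclideanSpace.proj (0 : Fin 1)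
  let z : E × EuclideanSpace ℝ (Fin 1) := extChartAt J p p
  let a : E × EuclideanSpace ℝ (Fin 1) := v
  have c₁ : ContDiffOn ℝ ∞ h₁ D := contDiffOn_derivWithin_halfOpenSet h_smooth
  have c₂ : ContDiffOn ℝ ∞ h₂ D := contDiffOn_derivWithin_halfOpenSet c₁
  have hrange : range J = {y | 0 ≤ τ y.2} := range_prod_halfOpen
  have H := eventually_isWarpedAt gN h_smooth h_pos p
  have hzD : τ z.2 ∈ D := extChartAt_halfOpen_target p (mem_extChartAt_target p)
  have htarget : ∀ᶠ y in 𝓝[{y | 0 ≤ τ y.2}] z, y ∈ (extChartAt J p).target := by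
    rw [← hrange]
    exact extChartAt_target_mem_nhdsWithin (I := J) p
  have Hz : CoordMetric.IsWarpedAt τ (EuclideanSpace.single 0 1) h h₁ K G z :=
    H.self_of_nhdsWithin hzD.1
  have hf' : ∀ᶠ y in 𝓝[{y | 0 ≤ τ y.2}] z, (f ∘ (extChartAt J p).symm) y = h₁ (τ y.2) :=
    htarget.mono fun y hy => by
      rw [Function.comp_apply, hf, radius_extChartAt_symm p hy]
      rfl
  have d₁ : ∀ᶠ y in 𝓝[{y : E × EuclideanSpace ℝ (Fin 1) | 0 ≤ τ y.2}] z,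
      HasDerivWithinAt h₁ (h₂ (τ y.2)) (Ici 0) (τ y.2) :=
    htarget.mono fun y hy =>
      hasDerivWithinAt_Ici_of_contDiffOn c₁ (extChartAt_halfOpen_target p hy)
  have d₂ : HasDerivWithinAt h₂ (h₃ (τ z.2)) (Ici 0) (τ z.2) :=
    hasDerivWithinAt_Ici_of_contDiffOn c₂ hzD
  have hΓ : DifferentiableAt ℝ (CoordMetric.christoffel K univ) z.1 := by
    have h1 := contDiffWithinAt_metricInChart gN.contMDiff p.1
    rw [I.range_eq_univ] at h1
    exact differentiableWithinAt_univ.1 (CoordMetric.differentiableWithinAt_christoffel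
      uniqueDiffOn_univ (mem_univ _) h1 Hz.injective)
  have eRic := CoordMetric.IsWarpedAt.ricci_eq H hzD.1 hΓ (d₁.self_of_nhdsWithin hzD.1) a
  have eHess := CoordMetric.IsWarpedAt.hessian_eq H hzD.1 hf' d₁ d₂ a a
  have eLap := CoordMetric.IsWarpedAt.laplacian_eq H hzD.1 hf' d₁ d₂
  have eg : warpedMetric I R gN.inner h p v v = τ a.2 * τ a.2 + h (τ z.2) ^ 2 * K z.1 a.1 a.1 := by
    rw [← Hz.metric_self a a]
    exact (DFunLike.congr_fun (DFunLike.congr_fun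
      (metricInChart_self (I := J) (warpedMetric I R gN.inner h) p) a) a).symm
  have hK : K z.1 a.1 a.1 = gN.inner p.1 a.1 a.1 :=
    DFunLike.congr_fun (DFunLike.congr_fun (metricInChart_self (I := I) gN.inner p.1) a.1) a.1
  have hg_nonneg : ∀ u : TangentSpace I p.1, 0 ≤ gN.inner p.1 u u := fun u => by
    rcases eq_or_ne u 0 with h0 | h0
    · simp [h0]
    · exact (gN.pos p.1 u h0).le
  have hKnn : 0 ≤ K z.1 a.1 a.1 := (hg_nonneg a.1).trans_eq hK.symm
  have hRicN : (n - 2) * ρ * K z.1 a.1 a.1 ≤ CoordMetric.ricci K univ z.1 a.1 a.1 := by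
    rw [hK]
    refine (hRic p.1 a.1).trans_eq ?_
    change CoordMetric.ricci K (range I) z.1 a.1 a.1 = _
    rw [I.range_eq_univ]
  have hW := warping_inequality h_smooth h_pos h_mono hzD
  have hfp : f p = h₁ (τ z.2) := hf p
  have hf0 : 0 ≤ h₁ (τ z.2) := h_nonneg _ hzD
  have hne := Hz.ne_zero
  rw [laplaceBeltrami, hessianTensor, ricciTensor, hfp, eg, hrange]
  refine le_of_le_of_eq ?_ (congrArg₂ (fun x y => x + h₁ (τ z.2) * y) (congrArg₂ (fun x y =>
    x * (τ a.2 * τ a.2 + h (τ z.2) ^ 2 * K z.1 a.1 a.1) - y) eLap.symm eHess.symm) eRic.symm)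
  -- The tangential remainder: the warping inequality times `g_N(a, a)`, plus `h'` times the excess
  -- of `Ric_N` over its lower bound.
  have key := add_nonneg (mul_nonneg hKnn hW) (mul_nonneg hf0 (sub_nonneg.2 hRicN))
  refine key.trans_eq ?_
  change K z.1 a.1 a.1 * (h (τ z.2) ^ 2 * h₃ (τ z.2) + (n - 3) * h (τ z.2) * h₁ (τ z.2) *
    h₂ (τ z.2) + (n - 2) * (ρ - h₁ (τ z.2) ^ 2) * h₁ (τ z.2)) + _ =
    (h₃ (τ z.2) + Module.finrank ℝ E * (h₁ (τ z.2) * h₂ (τ z.2) / h (τ z.2))) *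
      (τ a.2 * τ a.2 + h (τ z.2) ^ 2 * K z.1 a.1 a.1)
    - (h₃ (τ z.2) * τ a.2 * τ a.2 + h (τ z.2) * h₁ (τ z.2) * h₂ (τ z.2) * K z.1 a.1 a.1)
    + h₁ (τ z.2) * (CoordMetric.ricci K univ z.1 a.1 a.1
        - (h (τ z.2) * h₂ (τ z.2) + (Module.finrank ℝ E - 1) * h₁ (τ z.2) ^ 2) * K z.1 a.1 a.1
        - Module.finrank ℝ E * (h₂ (τ z.2) / h (τ z.2)) * τ a.2 ^ 2)
  rw [hn]
  -- The `τ(a)²` terms cancel here once `dim E = n - 1` is inserted.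
  field_simp
  ring

end WarpedProduct

theorem proposition2p1 (n : ℕ) (hn : 3 ≤ n)
    {N : Type*} [TopologicalSpace N] [T2Space N] [CompactSpace N]
    [ChartedSpace (EuclideanSpace ℝ (Fin (n - 1))) N] [IsManifold (𝓡 (n - 1)) ∞ N]
    (gN : ContMDiffRiemannianMetric (𝓡 (n - 1)) ∞ (EuclideanSpace ℝ (Fin (n - 1)))
      (fun x : N => TangentSpace (𝓡 (n - 1)) x))
    (ρ : ℝ)
    (hRic : ∀ (x : N) (v : TangentSpace (𝓡 (n - 1)) x),
      ((n : ℝ) - 2) * ρ * gN.inner x v v ≤ ricciTensor (𝓡 (n - 1)) gN.inner x v v)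
    (R : EReal) (hR : 0 < R) (h : ℝ → ℝ)
    (h_smooth : ContDiffOn ℝ ∞ h (halfOpenSet R))
    (h_pos : ∀ r ∈ halfOpenSet R, 0 < h r)
    (H1 : derivWithin h (halfOpenSet R) 0 = 0 ∧ 0 < iteratedDerivWithin 2 h (halfOpenSet R) 0)
    (H2 : ∀ r ∈ halfOpenSet R, 0 < r → 0 < derivWithin h (halfOpenSet R) r)
    (H3 : MonotoneOn
      (fun r => 2 * (iteratedDerivWithin 2 h (halfOpenSet R) r / h r)
        - ((n : ℝ) - 2) * ((ρ - derivWithin h (halfOpenSet R) r ^ 2) / h r ^ 2))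
      {r | r ∈ halfOpenSet R ∧ 0 < r})
    (f : N × HalfOpen R → ℝ) (hf : ∀ p, f p = derivWithin h (halfOpenSet R) (radius p))
    (g : ∀ p : N × HalfOpen R, TangentSpace ((𝓡 (n - 1)).prod (𝓡∂ 1)) p →L[ℝ]
      TangentSpace ((𝓡 (n - 1)).prod (𝓡∂ 1)) p →L[ℝ] ℝ)
    (hg : g = warpedMetric (𝓡 (n - 1)) R gN.inner h)
    (p : N × HalfOpen R) (v : TangentSpace ((𝓡 (n - 1)).prod (𝓡∂ 1)) p) :
    0 ≤ laplaceBeltrami ((𝓡 (n - 1)).prod (𝓡∂ 1)) g f p * g p v v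
      - hessianTensor ((𝓡 (n - 1)).prod (𝓡∂ 1)) g f p v v
      + f p * ricciTensor ((𝓡 (n - 1)).prod (𝓡∂ 1)) g p v v := by
  subst hg
  have hm : (Module.finrank ℝ (EuclideanSpace ℝ (Fin (n - 1))) : ℝ) = n - 1 := by
    rw [finrank_euclideanSpace_fin, Nat.cast_sub (by omega)]
    simp
  refine warpedProduct_nonneg hm gN ρ hRic h h_smooth h_pos (fun r hr => ?_) H3 f hf p v
  -- `h' ≥ 0` on all of `[0, R)`: equality at the boundary from (H1), strict inequality inside from
  -- (H2).
  rcases hr.1.eq_or_lt with h0 | h0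
  · rw [← h0]
    exact H1.1.ge
  · exact (H2 r hr h0).le
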